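/- For a positive integer $n$ let $P=\mathrm{COR}(n)=\operatorname{conv}\{bb^{\intercal} : b\in\{0,1\}^n\}\subseteq\mathbb{R}^{n\times n}$ be the correlation polytope and let $$Q=Q(n)=\{x\in\mathbb{R}^{n\times n} : \langle 2\operatorname{diag}(a)-aa^{\intercal},x\rangle\le 1\ \text{ for all } a\in\{0,1\}^n\},$$ where $\langle\cdot,\cdot\rangle$ is the Frobenius inner product, and for $\rho\ge 1$ let $\rho Q=\{\rho x : x\in Q\}$. For sets $P\subseteq Q'$ in a real vector space $\mathbb{R}^d$, an extended formulation of size $r$ of the pair $P,Q'$ is a system $Ex+Fy=g$, $y\ge 0$, with $y\in\mathbb{R}^r$ and any finite number of equations, such that $K=\{x\in\mathbb{R}^d : \exists y\ge 0,\ Ex+Fy=g\}$ satisfies $P\subseteq K\subseteq Q'$; $\mathrm{xc}(P,Q')$ is the minimum size of such an extended formulation. Then the following hold. 1. If $\rho\ge 1$ is a fixed constant, then $\mathrm{xc}(P,\rho Q)=2^{\Omega(n)}$: for every real $\rho\ge1$ there are $c>0$ and $N$ such that $\mathrm{xc}(\mathrm{COR}(n),\rho\,Q(n))\ge 2^{cn}$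 for all $n\ge N$. 2. If $\rho\ge 1$ and $\rho=O(n^{\beta})$ for some constant $\beta<1/2$, then $\mathrm{xc}(P,\rho Q)=2^{\Omega(n^{1-2\beta})}$: for all reals $\beta<1/2$ and $C>0$ there are $c>0$ and $N$ such that $\mathrm{xc}(\mathrm{COR}(n),\rho\,Q(n))\ge 2^{c\,n^{1-2\beta}}$ for all $n\ge N$ and all real $\rho$ with $1\le\rho\le C n^{\beta}$. -/

import Mathlib

open scoped Pointwise Matrix

/-- The vectors in `ℝⁿ` all of whose coordinates are `0` or `1`. -/
def binaryVectors (n : ℕ) : Set (Fin n → ℝ) :=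
  {b | ∀ i, b i = 0 ∨ b i = 1}

/-- The Frobenius inner product of two real `n × n` matrices. -/
def frobeniusInner {n : ℕ} (A X : Matrix (Fin n) (Fin n) ℝ) : ℝ :=
  ∑ i, ∑ j, A i j * X i j

/-- The correlation polytope `COR(n) = conv {b bᵀ | b ∈ {0,1}ⁿ}`. -/
def correlationPolytope (n : ℕ) : Set (Matrix (Fin n) (Fin n) ℝ) :=
  convexHull ℝ {x | ∃ b ∈ binaryVectors n, x = Matrix.vecMulVec b b}

/-- The outer polyhedron `Q(n) = {x | ⟨2 diag(a) - a aᵀ, x⟩ ≤ 1 for all a ∈ {0,1}ⁿ}`. -/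
def outerPolyhedron (n : ℕ) : Set (Matrix (Fin n) (Fin n) ℝ) :=
  {x | ∀ a ∈ binaryVectors n,
    frobeniusInner ((2 : ℝ) • Matrix.diagonal a - Matrix.vecMulVec a a) x ≤ 1}

section ExtendedFormulations

variable {V : Type*} [AddCommGroup V] [Module ℝ V]

/-- The polyhedron `{x | ∃ y ≥ 0, E x + F y = g}` defined by the system `E x + F y = g`, `y ≥ 0`
with `k` equations and `r` nonnegative auxiliary variables. -/
def projectedPolyhedron {k r : ℕ} (E : V →ₗ[ℝ] (Fin k → ℝ)) (F : Matrix (Fin k) (Fin r) ℝ)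
    (g : Fin k → ℝ) : Set V :=
  {x | ∃ y : Fin r → ℝ, (∀ i, 0 ≤ y i) ∧ E x + F *ᵥ y = g}

/-- The pair `P, Q` has an extended formulation of size `r`: a system `E x + F y = g`, `y ≥ 0` with
`y ∈ ℝʳ` (and any finite number of equations) that defines a polyhedron `K` with `P ⊆ K ⊆ Q`. -/
def HasExtendedFormulation (P Q : Set V) (r : ℕ) : Prop :=
  ∃ (k : ℕ) (E : V →ₗ[ℝ] (Fin k → ℝ)) (F : Matrix (Fin k) (Fin r) ℝ) (g : Fin k → ℝ),
    P ⊆ projectedPolyhedron E F g ∧ projectedPolyhedron E F g ⊆ Q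

/-- The extension complexity `xc(P, Q)`: the minimum size of an extended formulation of the
pair `P, Q`. (The value is `0` if there is none, so a positive lower bound on it includes the
existence of an extended formulation.) -/
noncomputable def extensionComplexity (P Q : Set V) : ℕ :=
  sInf {r | HasExtendedFormulation P Q r}

end ExtendedFormulations

/-! By Farkas' lemma an extended formulation of size r writes the slack matrix ρ - 1 + (1 - |a ∩
b|)² as a sum of r + 1 nonnegative rank-one terms
(`exists_factorization_of_hasExtendedFormulation`). This matrix is ρ on disjoint pairs and ρ - 1 on
pairs meeting in one point.

Draw S uniformly, then a ⊆ S and b ⊆ Sᶜ uniformly, and compare with the pair obtained by inserting i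
into both sets. For one term f gᵀ the drop of the mean is bounded by the effect of coordinate i on f
and on g, which is a degree-one Fourier coefficient. A sub-Gaussian estimate bounds the sum over i
of these coefficients by εn times the mean plus an error of order exp(-ε²n/2)
(`sum_abs_expect_coordSign_le`, `sum_expect_disjoint_sub_intersecting_le`).

Summed over all terms, the drop is 1 for each i and the disjoint means add up to ρ. Hence n ≤ 8(εnρ
+ (r + 1)(B/ε) exp(-ε²n/2)), where B bounds the matrix entries. Taking ε = 1/(16ρ) makes r
exponential in n/ρ², up to polynomial factors. -/

open Finset
open scoped BigOperators

/-! ### Fourier analysis on the cube and the corruption bound -/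

section Corruption

variable {α : Type*} [Fintype α] [DecidableEq α]

/-- Averaging over all subsets is the same as averaging over the two choices at `i`. -/
lemma expect_erase_insert (i : α) (h : Finset α → ℝ) :
    𝔼 a, h a = 𝔼 a, (h (a.erase i) + h (insert i a)) / 2 := by
  have hinv : Function.Involutive (fun a : Finset α => symmDiff a {i}) := fun a => by simp
  have h1 : 𝔼 a, h a = 𝔼 a, h (symmDiff a {i}) :=
    (Fintype.expect_bijective _ hinv.bijective _ _ fun a => rfl).symm
  have h2 : 𝔼 a, h a = 𝔼 a, (h a + h (symmDiff a {i})) / 2 := by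
    rw [← expect_div, expect_add_distrib, ← h1]; ring
  rw [h2]
  refine expect_congr rfl fun a _ => ?_
  by_cases hi : i ∈ a
  · have e1 : symmDiff a {i} = a.erase i := by
      ext j; simp only [mem_symmDiff, mem_singleton, mem_erase]; grind
    rw [e1, insert_eq_of_mem hi, add_comm]
  · have e1 : symmDiff a {i} = insert i a := by
      ext j; simp only [mem_symmDiff, mem_singleton, mem_insert]; grind
    rw [e1, erase_eq_of_notMem hi]

lemma expect_compl (h : Finset α → ℝ) : 𝔼 a, h aᶜ = 𝔼 a, h a :=
  Fintype.expect_bijective _ compl_involutive.bijective _ _ fun _ => rfl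

/-- The `±1`-valued character of the cube at the coordinate `i`. -/
def coordSign (i : α) (a : Finset α) : ℝ := if i ∈ a then 1 else -1

/-- The coordinates are independent, so the moment generating function is a product of hyperbolic
cosines, and cosh x ≤ exp(x²/2). -/
lemma expect_exp_sum_coordSign_le (lam : ℝ) (σ : α → ℝ) (hσ : ∀ i, |σ i| ≤ 1) :
    𝔼 a : Finset α, Real.exp (lam * ∑ i, σ i * coordSign i a) ≤
      Real.exp (lam ^ 2 * Fintype.card α / 2) := by
  have h1 : ∀ a : Finset α, Real.exp (lam * ∑ i, σ i * coordSign i a) =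
      (∏ i ∈ a, Real.exp (lam * σ i)) * ∏ i ∈ univ \ a, Real.exp (-(lam * σ i)) := by
    intro a
    rw [mul_sum, Real.exp_sum, ← prod_sdiff (subset_univ a), mul_comm]
    congr 1
    · refine prod_congr rfl fun i hi => ?_
      simp [coordSign, hi]
    · refine prod_congr rfl fun i hi => ?_
      rw [mem_sdiff] at hi
      simp [coordSign, hi.2]
  have h2 : ∑ a : Finset α, Real.exp (lam * ∑ i, σ i * coordSign i a) =
      ∏ i, (Real.exp (lam * σ i) + Real.exp (-(lam * σ i))) := by
    rw [prod_add, powerset_univ]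
    exact sum_congr rfl fun a _ => h1 a
  have h3 : ∀ i, Real.exp (lam * σ i) + Real.exp (-(lam * σ i)) ≤
      2 * Real.exp (lam ^ 2 / 2) := by
    intro i
    have := Real.cosh_le_exp_half_sq (lam * σ i)
    rw [Real.cosh_eq] at this
    have h4 : Real.exp ((lam * σ i) ^ 2 / 2) ≤ Real.exp (lam ^ 2 / 2) := by
      apply Real.exp_le_exp.2
      have : (σ i) ^ 2 ≤ 1 := (sq_le_one_iff_abs_le_one _).2 (hσ i)
      rw [mul_pow]
      nlinarith [sq_nonneg lam]
    linarith
  rw [Fintype.expect_eq_sum_div_card, h2, Fintype.card_finset, div_le_iff₀ (by positivity)]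
  calc _ ≤ ∏ _i : α, 2 * Real.exp (lam ^ 2 / 2) :=
        prod_le_prod (fun i _ => by positivity) fun i _ => h3 i
    _ = _ := by
        rw [prod_const, mul_pow, ← Real.exp_nat_mul, card_univ, mul_comm]
        push_cast
        congr 2
        ring

/-- A level-one inequality: the degree-one Fourier coefficients of a nonnegative bounded function
on the cube are small in `ℓ¹` compared to its mean. -/
lemma sum_abs_expect_coordSign_le (f : Finset α → ℝ) {U ε : ℝ} (hε : 0 < ε) (hf : ∀ a, 0 ≤ f a)
    (hU : ∀ a, f a ≤ U) :
    ∑ i, |𝔼 a, f a * coordSign i a| ≤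
      ε * Fintype.card α * 𝔼 a, f a + U / ε * Real.exp (-(ε ^ 2 * Fintype.card α / 2)) := by
  set n := (Fintype.card α : ℝ)
  have hU0 : 0 ≤ U := (hf ∅).trans (hU ∅)
  -- The signs turn the ℓ¹ norm of the coefficients into the correlation of f with a single linear
  -- form X.
  let σ : α → ℝ := fun i => SignType.sign (𝔼 a, f a * coordSign i a)
  have hσ : ∀ i, |σ i| ≤ 1 := by
    intro i
    rcases lt_trichotomy (𝔼 a, f a * coordSign i a) 0 with h | h | h <;> simp [σ, h]
  have h1 : ∑ i, |𝔼 a, f a * coordSign i a| = 𝔼 a, f a * ∑ i, σ i * coordSign i a := by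
    simp_rw [mul_sum, expect_sum_comm]
    refine sum_congr rfl fun i _ => ?_
    rw [← sign_mul_self, mul_expect]
    exact expect_congr rfl fun a _ => by simp only [σ]; ring
  have h2 : ∀ a : Finset α, f a * ∑ i, σ i * coordSign i a ≤ ε * n * f a +
      U / ε * Real.exp (-(ε ^ 2 * n)) * Real.exp (ε * ∑ i, σ i * coordSign i a) := by
    intro a
    set X := ∑ i, σ i * coordSign i a
    -- By 1 + t ≤ exp t, the excess of X over εn is at most an exponential. The crude bound f ≤ U is
    -- spent only on this excess.
    have h3 : ε * (X - ε * n) ≤ Real.exp (-(ε ^ 2 * n)) * Real.exp (ε * X) := by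
      rw [← Real.exp_add]
      have := Real.add_one_le_exp (-(ε ^ 2 * n) + ε * X)
      linarith
    have h4 : X - ε * n ≤ (Real.exp (-(ε ^ 2 * n)) * Real.exp (ε * X)) / ε := by
      rw [le_div_iff₀ hε]; linarith
    have h5 : f a * (X - ε * n) ≤ U * ((Real.exp (-(ε ^ 2 * n)) * Real.exp (ε * X)) / ε) :=
      (mul_le_mul_of_nonneg_left h4 (hf a)).trans
        (mul_le_mul_of_nonneg_right (hU a) (by positivity))
    calc f a * X = ε * n * f a + f a * (X - ε * n) := by ring
      _ ≤ _ := by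
        refine add_le_add le_rfl (h5.trans_eq ?_)
        ring
  rw [h1]
  refine (expect_le_expect fun a _ => h2 a).trans ?_
  rw [expect_add_distrib, ← mul_expect, ← mul_expect]
  refine add_le_add le_rfl ?_
  rw [mul_assoc]
  refine mul_le_mul_of_nonneg_left ?_ (by positivity)
  refine (mul_le_mul_of_nonneg_left (expect_exp_sum_coordSign_le ε σ hσ)
    (Real.exp_pos _).le).trans_eq ?_
  rw [← Real.exp_add]
  congr 1
  ring

/-- The mean of `f` over the subsets of `S`. -/
noncomputable def subsetMean (f : Finset α → ℝ) (S : Finset α) : ℝ := 𝔼 a, f (a ∩ S)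

lemma subsetMean_nonneg {f : Finset α → ℝ} (hf : ∀ a, 0 ≤ f a) (S : Finset α) :
    0 ≤ subsetMean f S := expect_nonneg fun _ _ => hf _

lemma subsetMean_le {f : Finset α → ℝ} {U : ℝ} (hf : ∀ a, f a ≤ U) (S : Finset α) :
    subsetMean f S ≤ U := expect_le univ_nonempty fun _ _ => hf _

lemma subsetMean_erase (f : Finset α → ℝ) (i : α) (S : Finset α) :
    subsetMean f (S.erase i) = subsetMean (fun a => f (a.erase i)) S :=
  expect_congr rfl fun a _ => by rw [inter_erase]

lemma subsetMean_insert (f : Finset α → ℝ) (i : α) (S : Finset α) :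
    subsetMean f (insert i S) = (subsetMean (fun a => f (a.erase i)) S +
      subsetMean (fun a => f (insert i a)) S) / 2 := by
  unfold subsetMean
  rw [expect_erase_insert i, ← expect_div, expect_add_distrib]
  congr 2
  · refine expect_congr rfl fun a _ => congrArg f ?_
    ext j; simp only [mem_inter, mem_erase, mem_insert]; grind
  · refine expect_congr rfl fun a _ => congrArg f ?_
    ext j; simp only [mem_inter, mem_insert]; grind

lemma subsetMean_congr_insert {f : Finset α → ℝ} {i : α}
    (hf : ∀ a b, insert i a = insert i b → f a = f b) (S : Finset α) :
    subsetMean f (insert i S) = subsetMean f S :=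
  expect_congr rfl fun a _ => hf _ _ <| by
    ext j; simp only [mem_inter, mem_insert]; grind

/-- The discrepancy of `f` on the subsets of `S` between the two choices at `i`. -/
noncomputable def influence (f : Finset α → ℝ) (i : α) (S : Finset α) : ℝ :=
  |subsetMean (fun a => f (insert i a)) S - subsetMean (fun a => f (a.erase i)) S|

lemma influence_insert (f : Finset α → ℝ) (i : α) (S : Finset α) :
    influence f i (insert i S) = influence f i S := by
  unfold influence
  rw [subsetMean_congr_insert, subsetMean_congr_insert]
  · intro a b h
    have : a.erase i = b.erase i := by
      ext j; have := congrArg (j ∈ ·) h; simp at this; grind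
    rw [this]
  · intro a b h; rw [h]

/-- Pairing a with and without i gives half the discrepancy at i if i ∈ S; otherwise a ∩ S ignores i
and the two signs cancel. -/
lemma two_mul_abs_expect_coordSign (f : Finset α → ℝ) (i : α) (S : Finset α) :
    2 * |𝔼 a, f (a ∩ S) * coordSign i a| = if i ∈ S then influence f i S else 0 := by
  rw [expect_erase_insert i]
  split_ifs with hi
  · have : ∀ a : Finset α, (f (a.erase i ∩ S) * coordSign i (a.erase i) +
        f (insert i a ∩ S) * coordSign i (insert i a)) / 2 =
        (f (insert i (a ∩ S)) - f ((a ∩ S).erase i)) / 2 := by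
      intro a
      rw [erase_inter, insert_inter_of_mem hi]
      simp [coordSign]; ring
    simp_rw [this]
    rw [← expect_div, expect_sub_distrib, abs_div, abs_two, mul_div_cancel₀ _ two_ne_zero]
    rfl
  · have : ∀ a : Finset α, (f (a.erase i ∩ S) * coordSign i (a.erase i) +
        f (insert i a ∩ S) * coordSign i (insert i a)) / 2 = 0 := by
      intro a
      rw [insert_inter_of_notMem hi, erase_inter,
        erase_eq_of_notMem (fun h => hi (mem_inter.1 h).2)]
      simp [coordSign]
    simp only [this, expect_const_zero, abs_zero, mul_zero]

/-- For each fixed S the level-one inequality applies to a ↦ f (a ∩ S). One factor 2 in the 4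
converts coefficients into influences; the other pays for i ∈ S having probability 1/2. -/
lemma sum_expect_influence_mul_le (f g : Finset α → ℝ) {U W ε : ℝ} (hε : 0 < ε)
    (hf : ∀ a, 0 ≤ f a) (hU : ∀ a, f a ≤ U) (hg : ∀ a, 0 ≤ g a) (hW : ∀ a, g a ≤ W) :
    ∑ i, 𝔼 S, influence f i S * subsetMean (fun b => g (b.erase i)) Sᶜ ≤
      4 * (ε * Fintype.card α * 𝔼 S, subsetMean f S * subsetMean g Sᶜ +
        U * W / ε * Real.exp (-(ε ^ 2 * Fintype.card α / 2))) := by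
  have hU0 : 0 ≤ U := (hf ∅).trans (hU ∅)
  have h1 : ∀ i, 𝔼 S, influence f i S * subsetMean (fun b => g (b.erase i)) Sᶜ =
      4 * 𝔼 S, subsetMean g Sᶜ * |𝔼 a, f (a ∩ S) * coordSign i a| := by
    intro i
    have : ∀ S, subsetMean g Sᶜ * |𝔼 a, f (a ∩ S) * coordSign i a| =
        (if i ∈ S then influence f i S else 0) * subsetMean g Sᶜ / 2 := by
      intro S; rw [← two_mul_abs_expect_coordSign]; ring
    simp_rw [this]
    rw [expect_erase_insert i (fun S => (if i ∈ S then influence f i S else 0) *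
      subsetMean g Sᶜ / 2), mul_expect]
    refine expect_congr rfl fun S _ => ?_
    have e : (insert i S)ᶜ = Sᶜ.erase i := by ext; simp
    rw [e, subsetMean_erase, if_pos (mem_insert_self i S), influence_insert]
    simp; ring
  simp_rw [h1]
  rw [← mul_sum, ← expect_sum_comm]
  refine mul_le_mul_of_nonneg_left ?_ (by norm_num)
  set δ := Real.exp (-(ε ^ 2 * Fintype.card α / 2))
  have h2 : ∀ S, ∑ i, subsetMean g Sᶜ * |𝔼 a, f (a ∩ S) * coordSign i a| ≤
      ε * Fintype.card α * (subsetMean f S * subsetMean g Sᶜ) + U * W / ε * δ := by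
    intro S
    rw [← mul_sum]
    have h3 := sum_abs_expect_coordSign_le (fun a => f (a ∩ S)) hε (fun a => hf _) (fun a => hU _)
    refine (mul_le_mul_of_nonneg_left h3 (subsetMean_nonneg hg _)).trans ?_
    rw [mul_add]
    refine add_le_add (le_of_eq ?_) ?_
    · simp only [subsetMean]; ring
    · have : U * W / ε * δ = W * (U / ε * δ) := by ring
      rw [this]
      exact mul_le_mul_of_nonneg_right (subsetMean_le hW _) (by positivity)
  refine (expect_le_expect fun S _ => h2 S).trans_eq ?_
  rw [expect_add_distrib, ← mul_expect, Fintype.expect_const]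

/-- The corruption bound for a single nonnegative rank-one matrix `f gᵀ`. -/
lemma sum_expect_disjoint_sub_intersecting_le (f g : Finset α → ℝ) {U W ε : ℝ} (hε : 0 < ε)
    (hf : ∀ a, 0 ≤ f a) (hU : ∀ a, f a ≤ U) (hg : ∀ a, 0 ≤ g a) (hW : ∀ a, g a ≤ W) :
    ∑ i, (𝔼 S, subsetMean f S * subsetMean g Sᶜ -
      𝔼 S, subsetMean (fun a => f (insert i a)) S * subsetMean (fun b => g (insert i b)) Sᶜ) ≤
      8 * (ε * Fintype.card α * 𝔼 S, subsetMean f S * subsetMean g Sᶜ +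
        U * W / ε * Real.exp (-(ε ^ 2 * Fintype.card α / 2))) := by
  have h1 : ∀ i, 𝔼 S, subsetMean f S * subsetMean g Sᶜ -
      𝔼 S, subsetMean (fun a => f (insert i a)) S * subsetMean (fun b => g (insert i b)) Sᶜ ≤
      𝔼 S, influence f i S * subsetMean (fun b => g (b.erase i)) Sᶜ +
      𝔼 S, influence g i S * subsetMean (fun b => f (b.erase i)) Sᶜ := by
    intro i
    rw [← expect_compl (fun S => influence g i S * subsetMean (fun b => f (b.erase i)) Sᶜ),
      expect_erase_insert i, ← expect_sub_distrib, ← expect_add_distrib]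
    refine expect_le_expect fun S _ => ?_
    have e : (insert i S)ᶜ = Sᶜ.erase i := by ext; simp
    have e' : (S.erase i)ᶜ = insert i Sᶜ := by ext; simp
    simp only [e, e', subsetMean_erase, subsetMean_insert, compl_compl, influence]
    have p1 := subsetMean_nonneg (f := fun a => f (a.erase i)) (fun a => hf _) S
    have p2 := subsetMean_nonneg (f := fun a => f (insert i a)) (fun a => hf _) S
    have p3 := subsetMean_nonneg (f := fun a => g (a.erase i)) (fun a => hg _) Sᶜ
    have p4 := subsetMean_nonneg (f := fun a => g (insert i a)) (fun a => hg _) Sᶜ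
    set F0 := subsetMean (fun a => f (a.erase i)) S
    set F1 := subsetMean (fun a => f (insert i a)) S
    set G0 := subsetMean (fun a => g (a.erase i)) Sᶜ
    set G1 := subsetMean (fun a => g (insert i a)) Sᶜ
    -- Averaging over whether i ∈ S, what remains is (2·F0·G0 + F0·G1 + F1·G0)/4 - F1·G1 ≤ |F1 -
    -- F0|·G0 + |G1 - G0|·F0.
    rcases le_total F0 F1 with hF | hF <;> rcases le_total G0 G1 with hG | hG
    · rw [abs_of_nonneg (sub_nonneg.2 hF), abs_of_nonneg (sub_nonneg.2 hG)]
      nlinarith [mul_nonneg p1 p3, mul_nonneg (sub_nonneg.2 hF) p3, mul_nonneg (sub_nonneg.2 hG) p1,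
        mul_nonneg (sub_nonneg.2 hF) (sub_nonneg.2 hG)]
    · rw [abs_of_nonneg (sub_nonneg.2 hF), abs_of_nonpos (sub_nonpos.2 hG)]
      nlinarith [mul_nonneg (sub_nonneg.2 hF) p3, mul_nonneg (sub_nonneg.2 hG) p1,
        mul_nonneg (sub_nonneg.2 hF) p4]
    · rw [abs_of_nonpos (sub_nonpos.2 hF), abs_of_nonneg (sub_nonneg.2 hG)]
      nlinarith [mul_nonneg (sub_nonneg.2 hF) p3, mul_nonneg (sub_nonneg.2 hG) p1,
        mul_nonneg (sub_nonneg.2 hG) p2]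
    · rw [abs_of_nonpos (sub_nonpos.2 hF), abs_of_nonpos (sub_nonpos.2 hG)]
      nlinarith [mul_nonneg (sub_nonneg.2 hF) p3, mul_nonneg (sub_nonneg.2 hG) p1,
        mul_nonneg (sub_nonneg.2 hF) (sub_nonneg.2 hG)]
  refine (sum_le_sum fun i _ => h1 i).trans ?_
  rw [sum_add_distrib]
  have h2 := sum_expect_influence_mul_le f g hε hf hU hg hW
  have h3 := sum_expect_influence_mul_le g f hε hg hW hf hU
  have h4 : 𝔼 S, subsetMean g S * subsetMean f Sᶜ = 𝔼 S, subsetMean f S * subsetMean g Sᶜ := by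
    rw [← expect_compl]
    exact expect_congr rfl fun S _ => by rw [compl_compl, mul_comm]
  rw [h4, mul_comm W U] at h3
  linarith

/-- For every S only pairs (a ∩ S, b ∩ Sᶜ) are sampled, and these are disjoint. -/
lemma expect_subsetMean_mul_eq_of_sum_eq {ι : Type*} [Fintype ι] (u v : ι → Finset α → ℝ) (c : ℝ)
    (h : ∀ a b, Disjoint a b → ∑ k, u k a * v k b = c) :
    ∑ k, 𝔼 S, subsetMean (u k) S * subsetMean (v k) Sᶜ = c := by
  have h1 : ∀ S : Finset α, ∑ k, subsetMean (u k) S * subsetMean (v k) Sᶜ = c := by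
    intro S
    simp only [subsetMean, expect_mul_expect]
    rw [← expect_sum_comm]
    refine (expect_congr rfl (g := fun _ => c) fun a _ => ?_).trans (Fintype.expect_const c)
    rw [← expect_sum_comm]
    refine (expect_congr rfl (g := fun _ => c) fun b _ => ?_).trans (Fintype.expect_const c)
    exact h _ _ ((disjoint_compl_right (a := S)).mono inter_subset_right inter_subset_right)
  rw [← expect_sum_comm]
  simp [h1]

/-- A lower bound on the size of a nonnegative factorization of a matrix that takes the value `ρ` on
disjoint pairs of sets and `ρ - 1` on pairs of sets with exactly one common element. -/
lemma card_le_of_nonneg_factorization {ι : Type*} [Fintype ι] (u v : ι → Finset α → ℝ)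
    {ρ B ε : ℝ} (hε : 0 < ε) (hu : ∀ k a, 0 ≤ u k a) (hv : ∀ k b, 0 ≤ v k b)
    (hB : ∀ a b, ∑ k, u k a * v k b ≤ B)
    (h0 : ∀ a b, Disjoint a b → ∑ k, u k a * v k b = ρ)
    (h1 : ∀ i a b, a ∩ b = {i} → ∑ k, u k a * v k b = ρ - 1) :
    (Fintype.card α : ℝ) ≤ 8 * (ε * Fintype.card α * ρ +
      Fintype.card ι * (B / ε * Real.exp (-(ε ^ 2 * Fintype.card α / 2)))) := by
  set δ := Real.exp (-(ε ^ 2 * Fintype.card α / 2))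
  have hk : ∀ k, ∑ i, (𝔼 S, subsetMean (u k) S * subsetMean (v k) Sᶜ -
      𝔼 S, subsetMean (fun a => u k (insert i a)) S *
        subsetMean (fun b => v k (insert i b)) Sᶜ) ≤
      8 * (ε * Fintype.card α * 𝔼 S, subsetMean (u k) S * subsetMean (v k) Sᶜ + B / ε * δ) := by
    intro k
    -- The maxima of the two factors are not bounded separately, but their product is one summand of
    -- an entry, hence at most B.
    obtain ⟨a₀, ha₀⟩ := Finite.exists_max (u k)
    obtain ⟨b₀, hb₀⟩ := Finite.exists_max (v k)
    have hUW : u k a₀ * v k b₀ ≤ B :=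
      (single_le_sum (f := fun k => u k a₀ * v k b₀) (fun k _ => mul_nonneg (hu _ _) (hv _ _))
        (mem_univ k)).trans (hB a₀ b₀)
    refine (sum_expect_disjoint_sub_intersecting_le _ _ hε (hu k) ha₀ (hv k) hb₀).trans ?_
    gcongr
  have hs := sum_le_sum fun k (_ : k ∈ (univ : Finset ι)) => hk k
  rw [sum_comm, ← mul_sum, sum_add_distrib, ← mul_sum,
    expect_subsetMean_mul_eq_of_sum_eq u v ρ h0] at hs
  have hi : ∀ i, ∑ k, (𝔼 S, subsetMean (u k) S * subsetMean (v k) Sᶜ -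
      𝔼 S, subsetMean (fun a => u k (insert i a)) S *
        subsetMean (fun b => v k (insert i b)) Sᶜ) = 1 := by
    intro i
    rw [sum_sub_distrib, expect_subsetMean_mul_eq_of_sum_eq u v ρ h0]
    have : ∑ k, 𝔼 S, subsetMean (fun a => u k (insert i a)) S *
        subsetMean (fun b => v k (insert i b)) Sᶜ = ρ - 1 :=
      expect_subsetMean_mul_eq_of_sum_eq (fun k a => u k (insert i a))
        (fun k b => v k (insert i b)) (ρ - 1) fun a b hab => h1 i _ _ <| by
          rw [← insert_inter_distrib, disjoint_iff_inter_eq_empty.1 hab, insert_empty_eq]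
    rw [this]; ring
  simp_rw [hi] at hs
  simpa using hs

end Corruption

/-! ### Farkas' lemma and slacks of projected polyhedra -/

/-- **Farkas' lemma** for finitely many linear functionals on an arbitrary real vector space. -/
lemma exists_nonneg_combination_of_forall_nonneg {W : Type*} [AddCommGroup W] [Module ℝ W] :
    ∀ {m : ℕ} (φ : Fin m → W →ₗ[ℝ] ℝ) (L : W →ₗ[ℝ] ℝ),
      (∀ x, (∀ i, 0 ≤ φ i x) → 0 ≤ L x) →
      ∃ c : Fin m → ℝ, (∀ i, 0 ≤ c i) ∧ ∀ x, L x = ∑ i, c i * φ i x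
  | 0, φ, L, h => ⟨0, by simp, fun x => by
      have h1 := h x (by simp)
      have h2 := h (-x) (by simp)
      rw [map_neg] at h2
      simp only [univ_eq_empty, sum_empty]
      linarith⟩
  | m + 1, φ, L, h => by
      by_cases hred : ∀ x, (∀ i : Fin m, 0 ≤ φ i.succ x) → 0 ≤ L x
      · obtain ⟨c, hc, hL⟩ := exists_nonneg_combination_of_forall_nonneg _ L hred
        refine ⟨Fin.cons 0 c, Fin.cases (by simp) (by simpa using hc), fun x => ?_⟩
        rw [Fin.sum_univ_succ, hL x]
        simp
      · push Not at hred
        obtain ⟨z, hz, hLz⟩ := hred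
        have hφz : φ 0 z < 0 := by
          by_contra! h0
          exact (h z (Fin.cases h0 hz)).not_gt hLz
        set t : ℝ := (-(φ 0 z))⁻¹
        have ht : 0 < t := inv_pos.2 (by linarith)
        set w : W := t • z
        have hw0 : φ 0 w = -1 := by
          simp only [w, t, map_smul, smul_eq_mul]
          rw [inv_neg, neg_mul, inv_mul_cancel₀ hφz.ne]
        have hw : ∀ i : Fin m, 0 ≤ φ i.succ w := fun i => by
          simp only [w, map_smul, smul_eq_mul]
          exact mul_nonneg ht.le (hz i)
        have hLw : L w < 0 := by
          simp only [w, map_smul, smul_eq_mul]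
          exact mul_neg_of_pos_of_neg ht hLz
        -- Since φ 0 w = -1, the map x ↦ x + φ 0 x • w projects onto the kernel of φ 0. The
        -- induction hypothesis is applied to the functionals composed with this projection; L w < 0
        -- then makes the coefficient of φ 0 nonnegative.
        obtain ⟨c, hc, hL⟩ := exists_nonneg_combination_of_forall_nonneg
          (fun i : Fin m => φ i.succ + φ i.succ w • φ 0) (L + L w • φ 0) (by
            intro x hx
            have h1 := h (x + φ 0 x • w) (Fin.cases (by simp [hw0]) fun i => by
              have := hx i
              simp only [LinearMap.add_apply, LinearMap.smul_apply, smul_eq_mul] at this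
              simp only [map_add, map_smul, smul_eq_mul]
              linarith)
            simp only [map_add, map_smul, smul_eq_mul] at h1
            simp only [LinearMap.add_apply, LinearMap.smul_apply, smul_eq_mul]
            linarith)
        refine ⟨Fin.cons (∑ i, c i * φ i.succ w - L w) c,
          fun i => ?_, fun x => ?_⟩
        · refine Fin.cases ?_ (by simpa using hc) i
          rw [Fin.cons_zero]
          have := sum_nonneg fun i (_ : i ∈ univ) => mul_nonneg (hc i) (hw i)
          linarith
        · have hx := hL x
          simp only [LinearMap.add_apply, LinearMap.smul_apply, smul_eq_mul, mul_add,
            sum_add_distrib] at hx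
          rw [Fin.sum_univ_succ]
          simp only [Fin.cons_zero, Fin.cons_succ]
          have : ∑ i, c i * (φ i.succ w * φ 0 x) = (∑ i, c i * φ i.succ w) * φ 0 x := by
            rw [sum_mul]; exact sum_congr rfl fun i _ => by ring
          rw [this] at hx
          linarith

section ExtendedFormulation

variable {V : Type*} [AddCommGroup V] [Module ℝ V]

/-- A linear inequality valid on a nonempty projected polyhedron has a slack that is a nonnegative
affine function of the auxiliary variables. -/
lemma exists_slack_of_valid_inequality {k r : ℕ} (E : V →ₗ[ℝ] (Fin k → ℝ))
    (F : Matrix (Fin k) (Fin r) ℝ) (g : Fin k → ℝ) (hne : (projectedPolyhedron E F g).Nonempty)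
    (L : V →ₗ[ℝ] ℝ) (ρ : ℝ) (hL : ∀ x ∈ projectedPolyhedron E F g, L x ≤ ρ) :
    ∃ (c₀ : ℝ) (c : Fin r → ℝ), 0 ≤ c₀ ∧ (∀ j, 0 ≤ c j) ∧
      ∀ x y, E x + F *ᵥ y = g → ρ - L x = c₀ + ∑ j, c j * y j := by
  obtain ⟨x₀, y₀, hy₀, h₀⟩ := hne
  -- Homogenization: on the kernel of A the system reads E x + F y = t g, and the only remaining
  -- constraints are t ≥ 0 and y ≥ 0.
  let A : (V × (Fin r → ℝ)) × ℝ →ₗ[ℝ] (Fin k → ℝ) :=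
    (E.coprod F.mulVecLin).coprod (-(LinearMap.toSpanSingleton ℝ (Fin k → ℝ) g))
  have hA : ∀ x y t, A ((x, y), t) = E x + F *ᵥ y - t • g := fun x y t => by
    simp [A, sub_eq_add_neg]
  let W := LinearMap.ker A
  let φ : Fin (r + 1) → W →ₗ[ℝ] ℝ := Fin.cons (LinearMap.snd ℝ _ _ ∘ₗ W.subtype)
    fun j => LinearMap.proj j ∘ₗ LinearMap.snd ℝ _ _ ∘ₗ LinearMap.fst ℝ _ _ ∘ₗ W.subtype
  let L' : W →ₗ[ℝ] ℝ := (ρ • LinearMap.snd ℝ _ _ -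
    L ∘ₗ LinearMap.fst ℝ _ _ ∘ₗ LinearMap.fst ℝ _ _) ∘ₗ W.subtype
  obtain ⟨c, hc, h⟩ := exists_nonneg_combination_of_forall_nonneg φ L' (by
    rintro ⟨⟨⟨x, y⟩, t⟩, hw⟩ hpos
    have hw' : E x + F *ᵥ y = t • g := by
      have : A ((x, y), t) = 0 := hw
      rw [hA] at this
      exact sub_eq_zero.1 this
    have ht : 0 ≤ t := hpos 0
    have hy : ∀ j, 0 ≤ y j := fun j => hpos j.succ
    change 0 ≤ ρ * t - L x
    -- For t = 0 the vector x is a recession direction, and L x > 0 would violate the bound ρ on the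
    -- ray from x₀. For t > 0 one rescales to t = 1.
    rcases ht.eq_or_lt with rfl | ht
    · rw [zero_smul] at hw'
      by_contra! hneg
      have hLx : 0 < L x := by linarith
      have hs : ∀ s : ℝ, 0 ≤ s → L x₀ + s * L x ≤ ρ := by
        intro s hs
        have := hL (x₀ + s • x) ⟨y₀ + s • y,
          fun j => add_nonneg (hy₀ j) (mul_nonneg hs (hy j)), by
            rw [map_add, map_smul, Matrix.mulVec_add, Matrix.mulVec_smul, add_add_add_comm, h₀,
              ← smul_add, hw', smul_zero, add_zero]⟩
        simpa using this
      have h1 := hs ((ρ - L x₀ + 1) / L x)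
        (div_nonneg (by have := hs 0 le_rfl; linarith) hLx.le)
      rw [div_mul_cancel₀ _ hLx.ne'] at h1
      linarith
    · have := hL (t⁻¹ • x) ⟨t⁻¹ • y, fun j => mul_nonneg (inv_nonneg.2 ht.le) (hy j), by
        rw [map_smul, Matrix.mulVec_smul, ← smul_add, hw', smul_smul, inv_mul_cancel₀ ht.ne',
          one_smul]⟩
      rw [map_smul, smul_eq_mul, inv_mul_le_iff₀ ht] at this
      linarith)
  refine ⟨c 0, fun j => c j.succ, hc 0, fun j => hc _, fun x y hxy => ?_⟩
  have hm : A ((x, y), 1) = 0 := by rw [hA, hxy, one_smul, sub_self]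
  have := h ⟨((x, y), 1), hm⟩
  rw [Fin.sum_univ_succ] at this
  change ρ * 1 - L x = c 0 * 1 + ∑ j : Fin r, c j.succ * y j at this
  linarith

lemma convex_projectedPolyhedron {k r : ℕ} (E : V →ₗ[ℝ] (Fin k → ℝ))
    (F : Matrix (Fin k) (Fin r) ℝ) (g : Fin k → ℝ) : Convex ℝ (projectedPolyhedron E F g) := by
  rintro x ⟨y, hy, h⟩ x' ⟨y', hy', h'⟩ s t hs ht hst
  refine ⟨s • y + t • y', fun i => add_nonneg (mul_nonneg hs (hy i)) (mul_nonneg ht (hy' i)), ?_⟩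
  rw [map_add, map_smul, map_smul, Matrix.mulVec_add, Matrix.mulVec_smul, Matrix.mulVec_smul,
    add_add_add_comm, ← smul_add, ← smul_add, h, h', ← add_smul, hst, one_smul]

end ExtendedFormulation

/-! ### The slack matrix of the correlation polytope -/

/-- The indicator vector of a set of coordinates. -/
def indicatorVec {n : ℕ} (a : Finset (Fin n)) : Fin n → ℝ := fun i => if i ∈ a then 1 else 0

lemma indicatorVec_mem {n : ℕ} (a : Finset (Fin n)) : indicatorVec a ∈ binaryVectors n := fun i => by
  by_cases h : i ∈ a <;> simp [indicatorVec, h]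

lemma exists_indicatorVec {n : ℕ} {b : Fin n → ℝ} (hb : b ∈ binaryVectors n) :
    ∃ a, b = indicatorVec a := by
  classical
  refine ⟨univ.filter fun i => b i = 1, funext fun i => ?_⟩
  rcases hb i with h | h <;> simp [indicatorVec, h]

/-- The Frobenius inner product with a fixed matrix, as a linear functional. -/
def frobeniusFunctional {n : ℕ} (A : Matrix (Fin n) (Fin n) ℝ) :
    Matrix (Fin n) (Fin n) ℝ →ₗ[ℝ] ℝ where
  toFun x := frobeniusInner A x
  map_add' x y := by simp [frobeniusInner, mul_add, sum_add_distrib]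
  map_smul' c x := by
    simp only [frobeniusInner, Matrix.smul_apply, smul_eq_mul, RingHom.id_apply, mul_sum]
    exact sum_congr rfl fun i _ => sum_congr rfl fun j _ => by ring

/-- With m = |a ∩ b| the diagonal part contributes 2m and the rank-one part m². -/
lemma frobeniusInner_vecMulVec {n : ℕ} (a b : Finset (Fin n)) :
    frobeniusInner ((2 : ℝ) • Matrix.diagonal (indicatorVec a) -
      Matrix.vecMulVec (indicatorVec a) (indicatorVec a))
      (Matrix.vecMulVec (indicatorVec b) (indicatorVec b)) = 1 - (1 - (#(a ∩ b) : ℝ)) ^ 2 := by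
  have hs : ∑ i, indicatorVec a i * indicatorVec b i = (#(a ∩ b) : ℝ) := by
    simp [indicatorVec, ← ite_and, ← mem_inter, inter_comm]
  have hd : ∀ i, indicatorVec b i * indicatorVec b i = indicatorVec b i := fun i => by
    by_cases h : i ∈ b <;> simp [indicatorVec, h]
  have h1 : ∀ i j, ((2 : ℝ) • Matrix.diagonal (indicatorVec a) -
      Matrix.vecMulVec (indicatorVec a) (indicatorVec a)) i j *
      Matrix.vecMulVec (indicatorVec b) (indicatorVec b) i j =
      (if i = j then 2 * (indicatorVec a i * indicatorVec b i) else 0) -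
      (indicatorVec a i * indicatorVec b i) * (indicatorVec a j * indicatorVec b j) := by
    intro i j
    simp only [Matrix.sub_apply, Matrix.smul_apply, Matrix.vecMulVec_apply, Matrix.diagonal_apply,
      smul_eq_mul]
    split_ifs with hij
    · subst hij
      rw [← hd i]
      ring_nf
      have := hd i
      have h2 : indicatorVec b i ^ 2 = indicatorVec b i := by rw [sq, hd]
      have h4 : indicatorVec b i ^ 4 = indicatorVec b i := by
        rw [show (4 : ℕ) = 2 * 2 from rfl, pow_mul, h2, h2]
      simp only [h2, h4]
    · ring
  simp only [frobeniusInner, h1, sum_sub_distrib, sum_ite_eq, mem_univ, if_true, ← mul_sum,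
    ← sum_mul, hs]
  ring

lemma frobeniusInner_le_of_mem_smul_outerPolyhedron {n : ℕ} {ρ : ℝ} (hρ : 0 ≤ ρ)
    {x : Matrix (Fin n) (Fin n) ℝ} (hx : x ∈ ρ • outerPolyhedron n) {a : Fin n → ℝ}
    (ha : a ∈ binaryVectors n) :
    frobeniusFunctional ((2 : ℝ) • Matrix.diagonal a - Matrix.vecMulVec a a) x ≤ ρ := by
  obtain ⟨q, hq, rfl⟩ := Set.mem_smul_set.1 hx
  rw [map_smul, smul_eq_mul]
  exact mul_le_of_le_one_right hρ (hq a ha)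

/-- An extended formulation of size `r` yields a nonnegative factorization with `r + 1` terms of the
slack matrix. -/
lemma exists_factorization_of_hasExtendedFormulation {n r : ℕ} {ρ : ℝ} (hρ : 0 ≤ ρ)
    (h : HasExtendedFormulation (correlationPolytope n) (ρ • outerPolyhedron n) r) :
    ∃ u v : Option (Fin r) → Finset (Fin n) → ℝ, (∀ k a, 0 ≤ u k a) ∧ (∀ k b, 0 ≤ v k b) ∧
      ∀ a b, ∑ k, u k a * v k b = ρ - 1 + (1 - (#(a ∩ b) : ℝ)) ^ 2 := by
  obtain ⟨k, E, F, g, hP, hQ⟩ := h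
  have hmem : ∀ b : Finset (Fin n), Matrix.vecMulVec (indicatorVec b) (indicatorVec b) ∈
      projectedPolyhedron E F g := fun b =>
    hP (subset_convexHull ℝ _ ⟨_, indicatorVec_mem b, rfl⟩)
  choose y hy hEy using hmem
  have hs := fun a : Finset (Fin n) => exists_slack_of_valid_inequality E F g
    ⟨_, hP (subset_convexHull ℝ _ ⟨_, indicatorVec_mem ∅, rfl⟩)⟩
    (frobeniusFunctional ((2 : ℝ) • Matrix.diagonal (indicatorVec a) -
      Matrix.vecMulVec (indicatorVec a) (indicatorVec a))) ρ
    fun x hx => frobeniusInner_le_of_mem_smul_outerPolyhedron hρ (hQ hx) (indicatorVec_mem a)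
  choose c₀ c hc₀ hc hslack using hs
  -- The index `none` carries the constant term of the slack, hence r + 1 terms.
  refine ⟨fun k a => k.elim (c₀ a) (c a), fun k b => k.elim 1 (y b), ?_, ?_, fun a b => ?_⟩
  · rintro (_ | j) a
    exacts [hc₀ a, hc a j]
  · rintro (_ | j) b
    exacts [zero_le_one, hy b j]
  · rw [Fintype.sum_option]
    have h1 := hslack a _ _ (hEy b)
    have h2 : frobeniusFunctional ((2 : ℝ) • Matrix.diagonal (indicatorVec a) -
      Matrix.vecMulVec (indicatorVec a) (indicatorVec a))
      (Matrix.vecMulVec (indicatorVec b) (indicatorVec b)) = _ := frobeniusInner_vecMulVec a b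
    rw [h2] at h1
    simp only [Option.elim_none, Option.elim_some, mul_one]
    rw [← h1]
    ring

/-- The vertices of the correlation polytope give an extended formulation. -/
lemma exists_hasExtendedFormulation (n : ℕ) {ρ : ℝ} (hρ : 1 ≤ ρ) :
    ∃ r, HasExtendedFormulation (correlationPolytope n) (ρ • outerPolyhedron n) r := by
  classical
  let e := Fintype.equivFin (Finset (Fin n))
  let d := Fintype.equivFin (Option (Fin n × Fin n))
  let X : Finset (Fin n) → Matrix (Fin n) (Fin n) ℝ := fun b =>
    Matrix.vecMulVec (indicatorVec b) (indicatorVec b)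
  -- Row `none` is the normalization ∑ y = 1; row `some (i, j)` is entry (i, j) of x = ∑ y_b b bᵀ.
  let E : Matrix (Fin n) (Fin n) ℝ →ₗ[ℝ] (Fin (Fintype.card (Option (Fin n × Fin n))) → ℝ) :=
    { toFun := fun x l => (d.symm l).elim 0 fun p => x p.1 p.2
      map_add' := fun x y => funext fun l => by rcases h : d.symm l <;> simp [h]
      map_smul' := fun c x => funext fun l => by rcases h : d.symm l <;> simp [h] }
  let F : Matrix (Fin (Fintype.card (Option (Fin n × Fin n))))
      (Fin (Fintype.card (Finset (Fin n)))) ℝ :=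
    Matrix.of fun l j => (d.symm l).elim 1 fun p => -X (e.symm j) p.1 p.2
  let g : Fin (Fintype.card (Option (Fin n × Fin n))) → ℝ := fun l => (d.symm l).elim 1 fun _ => 0
  have key : ∀ x y, E x + F *ᵥ y = g ↔ ∑ j, y j = 1 ∧ x = ∑ j, y j • X (e.symm j) := by
    intro x y
    have h1 : E x + F *ᵥ y = g ↔ ∀ o : Option (Fin n × Fin n),
        (o.elim 0 fun p => x p.1 p.2) + ∑ j, (o.elim 1 fun p => -X (e.symm j) p.1 p.2) * y j =
          o.elim (1 : ℝ) fun _ => 0 := by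
      rw [funext_iff, ← d.symm.forall_congr_right]
      rfl
    rw [h1, Option.forall]
    refine and_congr (by simp) ?_
    rw [← Matrix.ext_iff, Prod.forall]
    refine forall_congr' fun i => forall_congr' fun j => ?_
    simp only [Option.elim_some, Matrix.sum_apply, Matrix.smul_apply, smul_eq_mul, neg_mul,
      sum_neg_distrib, fun k => mul_comm (y k)]
    constructor <;> intro h <;> linarith
  refine ⟨_, _, E, F, g, ?_, ?_⟩
  · refine convexHull_min ?_ (convex_projectedPolyhedron E F g)
    rintro x ⟨b, hb, rfl⟩
    obtain ⟨a, rfl⟩ := exists_indicatorVec hb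
    refine ⟨Pi.single (e a) 1, fun i => ?_, (key _ _).2 ⟨by simp, ?_⟩⟩
    · by_cases h : i = e a
      · subst h; simp
      · simp [h]
    · rw [sum_eq_single (e a)]
      · simp [X]
      · intro j _ hj; simp [hj]
      · simp
  · rintro x ⟨y, hy, hxy⟩
    obtain ⟨h1, h2⟩ := (key x y).1 hxy
    rw [Set.mem_smul_set_iff_inv_smul_mem₀ (by linarith)]
    intro a ha
    obtain ⟨a, rfl⟩ := exists_indicatorVec ha
    change frobeniusFunctional _ _ ≤ 1
    rw [map_smul, smul_eq_mul, inv_mul_le_iff₀ (by linarith), mul_one, h2, map_sum]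
    refine le_trans ?_ hρ
    rw [← h1]
    refine sum_le_sum fun j _ => ?_
    rw [map_smul, smul_eq_mul]
    refine mul_le_of_le_one_right (hy j) ?_
    have h3 : frobeniusFunctional ((2 : ℝ) • Matrix.diagonal (indicatorVec a) -
      Matrix.vecMulVec (indicatorVec a) (indicatorVec a)) (X (e.symm j)) = _ :=
      frobeniusInner_vecMulVec a (e.symm j)
    rw [h3]
    linarith [sq_nonneg (1 - (#(a ∩ e.symm j) : ℝ))]

/-! ### Choice of parameters and asymptotics -/

lemma lower_bound_of_hasExtendedFormulation {n r : ℕ} {ρ : ℝ} (hn : 1 ≤ n) (hρ : 1 ≤ ρ)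
    (h : HasExtendedFormulation (correlationPolytope n) (ρ • outerPolyhedron n) r) :
    (n : ℝ) * Real.exp (n / (512 * ρ ^ 2)) ≤ 256 * (ρ * (ρ + n ^ 2)) * (r + 1) := by
  obtain ⟨u, v, hu, hv, huv⟩ := exists_factorization_of_hasExtendedFormulation (by linarith) h
  have hρ0 : 0 < ρ := by linarith
  have hn1 : (1 : ℝ) ≤ n := by exact_mod_cast hn
  -- This ε makes 8εnρ = n/2, which is absorbed on the left.
  have key := card_le_of_nonneg_factorization u v (ρ := ρ) (B := ρ + n ^ 2) (ε := 1 / (16 * ρ))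
    (by positivity) hu hv
    (fun a b => by
      rw [huv]
      have h1 : (#(a ∩ b) : ℝ) ≤ n := by
        exact_mod_cast (card_le_univ (a ∩ b)).trans_eq (Fintype.card_fin n)
      have h2 : (0 : ℝ) ≤ #(a ∩ b) := Nat.cast_nonneg _
      nlinarith)
    (fun a b hab => by rw [huv, disjoint_iff_inter_eq_empty.1 hab]; simp)
    (fun i a b hab => by rw [huv, hab]; simp)
  simp only [Fintype.card_fin, Fintype.card_option] at key
  have e1 : (1 / (16 * ρ)) ^ 2 * (n : ℝ) / 2 = n / (512 * ρ ^ 2) := by field_simp; norm_num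
  have e2 : 1 / (16 * ρ) * (n : ℝ) * ρ = n / 16 := by field_simp
  have e3 : (ρ + (n : ℝ) ^ 2) / (1 / (16 * ρ)) = 16 * (ρ * (ρ + n ^ 2)) := by field_simp
  rw [e1, e2, e3, Real.exp_neg] at key
  set x := Real.exp (n / (512 * ρ ^ 2))
  have hx : 0 < x := Real.exp_pos _
  push_cast at key
  have h2 : (n : ℝ) / 2 ≤ 128 * (ρ * (ρ + n ^ 2)) * (r + 1) / x := by
    rw [div_eq_mul_inv _ x]; linarith
  rw [le_div_iff₀ hx] at h2
  linarith

lemma eventually_const_mul_sq_le_exp_rpow {γ κ K : ℝ} (hγ : 0 < γ) (hκ : 0 < κ) :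
    ∀ᶠ n : ℕ in Filter.atTop, K * (n : ℝ) ^ 2 ≤ Real.exp (κ * (n : ℝ) ^ γ) := by
  have h1 := (tendsto_rpow_mul_exp_neg_mul_atTop_nhds_zero (2 / γ) κ hκ).comp
    ((tendsto_rpow_atTop hγ).comp tendsto_natCast_atTop_atTop)
  have h2 := (h1.const_mul K).eventually_le_const (u := 1) (by simp)
  filter_upwards [h2] with n hn
  simp only [Function.comp_apply] at hn
  rw [← Real.rpow_mul (Nat.cast_nonneg n), mul_div_cancel₀ _ hγ.ne', Real.rpow_two, neg_mul,
    Real.exp_neg, ← mul_assoc, ← div_eq_mul_inv, div_le_one (Real.exp_pos _)] at hn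
  exact hn

lemma two_rpow_le_extensionComplexity {β C : ℝ} (hβ : β < 1 / 2) (hC : 0 < C) :
    ∃ c : ℝ, 0 < c ∧ ∃ N : ℕ, ∀ n : ℕ, N ≤ n → ∀ ρ : ℝ, 1 ≤ ρ → ρ ≤ C * (n : ℝ) ^ β →
      (2 : ℝ) ^ (c * (n : ℝ) ^ (1 - 2 * β)) ≤
        (extensionComplexity (correlationPolytope n) (ρ • outerPolyhedron n) : ℝ) := by
  -- κ is half the exponent constant 1/(512 C²): of the resulting factor exp(2s), one exp(s) pays
  -- for the polynomial loss and the other is the final bound.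
  set κ : ℝ := 1 / (1024 * C ^ 2)
  set K : ℝ := 256 * (C * (C + 1))
  have hκ : 0 < κ := by positivity
  have hlog : 0 < Real.log 2 := Real.log_pos one_lt_two
  obtain ⟨N, hN⟩ := Filter.eventually_atTop.1
    (eventually_const_mul_sq_le_exp_rpow (γ := 1 - 2 * β) (K := 2 * K) (by linarith) hκ)
  refine ⟨κ / Real.log 2, by positivity, max N 1, fun n hn ρ hρ hρC => ?_⟩
  have hn1 : 1 ≤ n := (le_max_right _ _).trans hn
  have hn1' : (1 : ℝ) ≤ n := by exact_mod_cast hn1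
  have hn0 : (0 : ℝ) < n := by linarith
  have hbig := hN n ((le_max_left _ _).trans hn)
  -- Existence of a formulation is essential here: the infimum is then attained instead of taking
  -- the default value 0.
  have hmem : HasExtendedFormulation (correlationPolytope n) (ρ • outerPolyhedron n)
      (extensionComplexity (correlationPolytope n) (ρ • outerPolyhedron n)) :=
    Nat.sInf_mem (exists_hasExtendedFormulation n hρ)
  have hlb := lower_bound_of_hasExtendedFormulation hn1 hρ hmem
  set r := extensionComplexity (correlationPolytope n) (ρ • outerPolyhedron n)
  set s : ℝ := κ * (n : ℝ) ^ (1 - 2 * β)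
  have hs : (2 : ℝ) ^ (κ / Real.log 2 * (n : ℝ) ^ (1 - 2 * β)) = Real.exp s := by
    rw [Real.rpow_def_of_pos two_pos]
    congr 1
    simp only [s]
    field_simp
  rw [hs]
  have hs0 : 0 ≤ s := by positivity
  have hρ2 : 2 * s ≤ n / (512 * ρ ^ 2) := by
    have h1 : ρ ^ 2 ≤ C ^ 2 * (n : ℝ) ^ (2 * β) := by
      calc ρ ^ 2 ≤ (C * (n : ℝ) ^ β) ^ 2 := by gcongr
        _ = _ := by rw [mul_pow, ← Real.rpow_mul_natCast hn0.le]; norm_num [mul_comm]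
    calc 2 * s = n / (512 * (C ^ 2 * (n : ℝ) ^ (2 * β))) := by
          simp only [s, κ]
          rw [Real.rpow_sub hn0, Real.rpow_one]
          field_simp
          norm_num
      _ ≤ _ := by gcongr
  have hρn : ρ ≤ C * n := hρC.trans <| by
    gcongr
    calc (n : ℝ) ^ β ≤ (n : ℝ) ^ (1 : ℝ) := Real.rpow_le_rpow_of_exponent_le hn1' (by linarith)
      _ = n := Real.rpow_one _
  have hpoly : 256 * (ρ * (ρ + (n : ℝ) ^ 2)) ≤ n * (K * n ^ 2) := by
    calc 256 * (ρ * (ρ + (n : ℝ) ^ 2)) ≤ 256 * ((C * n) * (C * n ^ 2 + n ^ 2)) := by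
          have : ρ ≤ C * (n : ℝ) ^ 2 := hρn.trans (by gcongr; nlinarith)
          gcongr
      _ = _ := by simp only [K]; ring
  have hr0 : (0 : ℝ) ≤ r := Nat.cast_nonneg r
  have h1 : Real.exp s * Real.exp s ≤ K * n ^ 2 * (r + 1) := by
    refine le_of_mul_le_mul_left ?_ hn0
    calc n * (Real.exp s * Real.exp s) = n * Real.exp (2 * s) := by rw [← Real.exp_add]; ring_nf
      _ ≤ n * Real.exp (n / (512 * ρ ^ 2)) := by gcongr
      _ ≤ _ := hlb
      _ ≤ n * (K * n ^ 2) * (r + 1) := by gcongr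
      _ = _ := by ring
  -- The spare factor 2, from using 2K in `hbig`, absorbs the + 1 because exp s ≥ 1.
  have h2 : 2 * Real.exp s ≤ r + 1 := by
    have h3 : Real.exp s * (2 * Real.exp s) ≤ Real.exp s * (r + 1) := by nlinarith
    exact le_of_mul_le_mul_left h3 (Real.exp_pos s)
  have h4 : 1 ≤ Real.exp s := Real.one_le_exp hs0
  linarith

theorem theorem4 :
    (∀ ρ : ℝ, 1 ≤ ρ →
      ∃ c : ℝ, 0 < c ∧ ∃ N : ℕ, ∀ n : ℕ, N ≤ n →
        (2 : ℝ) ^ (c * (n : ℝ)) ≤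
          (extensionComplexity (correlationPolytope n) (ρ • outerPolyhedron n) : ℝ)) ∧
    (∀ β : ℝ, β < 1 / 2 → ∀ C : ℝ, 0 < C →
      ∃ c : ℝ, 0 < c ∧ ∃ N : ℕ, ∀ n : ℕ, N ≤ n → ∀ ρ : ℝ, 1 ≤ ρ → ρ ≤ C * (n : ℝ) ^ β →
        (2 : ℝ) ^ (c * (n : ℝ) ^ (1 - 2 * β)) ≤
          (extensionComplexity (correlationPolytope n) (ρ • outerPolyhedron n) : ℝ)) := by
  refine ⟨fun ρ hρ => ?_, fun β hβ C hC => two_rpow_le_extensionComplexity hβ hC⟩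
  -- A constant ρ is the case β = 0, C = ρ.
  obtain ⟨c, hc, N, h⟩ := two_rpow_le_extensionComplexity (β := 0) (C := ρ) (by norm_num)
    (by linarith)
  exact ⟨c, hc, N, fun n hn => by simpa using h n hn ρ hρ (by simp)⟩
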